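/- **Setting.** Let $x=(x_1,\dots,x_n)$, $u=(u^1,\dots,u^m)$, $v=(v^1,\dots,v^p)$. $J^k(x|u)$ is the $k$-th order jet space with coordinates $x_i$ and $u^a_\alpha$, $|\alpha|\le k$; $J^\infty(x|u)$ is the corresponding infinite-order jet space; similarly for $J^k(x|u,v)$, $J^\infty(x|u,v)$. A *differential function* is a smooth function of $x$ and finitely many derivatives of the unknown functions, defined on a fixed open domain of a jet space (for instance, on the whole jet space). $D_i=\partial_{x_i}+\sum_{a,\alpha}u^a_{\alpha+\delta_i}\partial_{u^a_\alpha}$ are the total derivatives and $\mathrm{Div}\,F=\sum_i D_iF^i$. Let $\mathcal L$ be a system $L^1=\dots=L^l=0$ of differential equations for $u$, the $L^\mu$ being differential functions. A *conserved vector* of $\mathcal L$ is an $n$-tuple $F=(F^1,\dots,F^n)$ of differential functions such that $\mathrm{Div}\,F$ vanishes on all local smooth solutions of $\mathcal L$. It is *trivial* if $F=\hat F+\check F$, where the tuples $\hat F$, $\check F$ consist of differential functions, $\hat F$ vanishes on all solutions of $\mathcal L$ and $\mathrm{Div}\,\check F\equiv0$. The *conservation laws* of $\mathcal L$ are the elements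 of the quotient space $\mathrm{CL}(\mathcal L)=\mathrm{CV}(\mathcal L)/\mathrm{CV}_0(\mathcal L)$ of conserved vectors modulo trivial ones. A *differential consequence* of $\mathcal L$ is an equation $H=0$ with $H$ a finite sum $\sum\lambda_{\mu,\alpha}D^\alpha L^\mu$, where the $\lambda_{\mu,\alpha}$ are differential functions, and $\mathcal L_{(k)}\subset J^k(x|u)$ is the set determined by all differential consequences of order at most $k$. The system is *totally nondegenerate* if for every $k\ge1$ each point of $\mathcal L_{(k)}$ is the $k$-jet of a local solution and $\mathcal L_{(k)}$ is the solution set of finitely many differential consequences of order at most $k$ whose differentials are linearly independent at each point of $\mathcal L_{(k)}$. Let $\bar{\mathcal L}$ be a system for the unknown functions $(u,v)$, with the analogous notions. Let $\varpi\colon J^\infty(x|u,v)\to J^\infty(x|u)$ and $\varpi_k\colon J^k(x|u,v)\to J^k(x|u)$ be the projections forgetting $v$ and its derivatives; $\varpi$ is assumed to map the domain of $\bar{\mathcal L}$ onto the domain of $\mathcal L$ (which is automatic when both are the whole jet spaces). $\bar{\mathcal L}$ is *foliated over the base system* $\mathcal L$ if both systems are totally nondegenerate and $\varpi_k(\bar{\mathcal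 L}_{(k)})=\mathcal L_{(k)}$ for every $k\ge1$. A conservation law $\bar{\mathcal F}$ of $\bar{\mathcal L}$ is *induced* by a conservation law $\mathcal F$ of $\mathcal L$ if some conserved vector $\bar F\in\bar{\mathcal F}$ is the pullback $F\circ\varpi$ of some conserved vector $F\in\mathcal F$. **Proposition.** Let $\bar{\mathcal L}$ be foliated over $\mathcal L$ and let $\bar{\mathcal F}$ be a conservation law of $\bar{\mathcal L}$. Then $\bar{\mathcal F}$ is induced by some conservation law of $\mathcal L$ if and only if $\bar{\mathcal F}$ contains a conserved vector which does not depend on the derivatives of $v$ (including $v$ itself as derivative of order zero), i.e., whose components take equal values at any two points of the domain with the same $x$ and the same derivatives of $u$. Moreover, every conserved vector $\bar F\in\bar{\mathcal F}$ which does not depend on the derivatives of $v$ is the pullback of a conserved vector belonging to a conservation law $\mathcal F$ of $\mathcal L$ that induces $\bar{\mathcal F}$. -/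

import Mathlib

open scoped ContDiff

noncomputable section

namespace JetCL

/-- Multi-indices `α ∈ ℕⁿ` with `|α| ≤ k`. -/
abbrev MultiIdx (n k : ℕ) : Type := {α : Fin n → ℕ // ∑ i, α i ≤ k}

instance instFiniteMultiIdx (n k : ℕ) : Finite (MultiIdx n k) := by
  refine Finite.of_injective
    (fun (α : MultiIdx n k) (i : Fin n) =>
      (⟨α.1 i, Nat.lt_succ_of_le ((Finset.single_le_sum (f := α.1)
        (fun _ _ => Nat.zero_le _) (Finset.mem_univ i)).trans α.2)⟩ : Fin (k + 1))) ?_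
  intro α β h
  ext i
  simpa using congrArg Fin.val (congrFun h i)

instance instFintypeMultiIdx (n k : ℕ) : Fintype (MultiIdx n k) := Fintype.ofFinite _

/-- The infinite-order jet space `J^∞(x|u)` for `n` independent variables `x` and dependent
variables `u` indexed by `ι`; a point has the coordinates `x_i` and `u^a_α`. -/
abbrev Jet (n : ℕ) (ι : Type) : Type := (Fin n → ℝ) × (ι → (Fin n → ℕ) → ℝ)

/-- The `k`-th order jet space `J^k(x|u)`, with the coordinates `x_i` and `u^a_α`, `|α| ≤ k`. -/
abbrev JetK (n : ℕ) (ι : Type) (k : ℕ) : Type := (Fin n → ℝ) × (ι → MultiIdx n k → ℝ)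

variable {n : ℕ} {ι : Type}

/-- The projection `J^∞(x|u) → J^k(x|u)`. -/
def proj (k : ℕ) (j : Jet n ι) : JetK n ι k := (j.1, fun a α => j.2 a α.1)

/-- The projection `J^K(x|u) → J^k(x|u)` for `k ≤ K`. -/
def trunc {k K : ℕ} (h : k ≤ K) (ξ : JetK n ι K) : JetK n ι k :=
  (ξ.1, fun a α => ξ.2 a ⟨α.1, α.2.trans h⟩)

/-- The partial derivative `∂f/∂x_i`. -/
def pderiv (i : Fin n) (f : (Fin n → ℝ) → ℝ) (x : Fin n → ℝ) : ℝ :=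
  lineDeriv ℝ f x (Pi.single i 1)

/-- `∂^{|α|} f / ∂x_1^{α_1} … ∂x_n^{α_n}`. -/
def mderiv (α : Fin n → ℕ) (f : (Fin n → ℝ) → ℝ) : (Fin n → ℝ) → ℝ :=
  (List.finRange n).foldr (fun i g => (pderiv i)^[α i] g) f

/-- The infinite jet at `x` of a function `u` of the independent variables. -/
def jet (u : (Fin n → ℝ) → ι → ℝ) (x : Fin n → ℝ) : Jet n ι :=
  (x, fun a α => mderiv α (fun y => u y a) x)

/-- The value at the point `j` of the vector field
`∂_{x_i} + ∑_{a,α} u^a_{α+δ_i} ∂_{u^a_α}` on `J^∞(x|u)`. -/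
def totalField (i : Fin n) (j : Jet n ι) : Jet n ι :=
  (Pi.single i 1, fun a α => j.2 a (α + Pi.single i 1))

/-- The total derivative `D_i F`: the derivative of `F` along the vector field
`∂_{x_i} + ∑_{a,α} u^a_{α+δ_i} ∂_{u^a_α}`. -/
def totalDeriv (i : Fin n) (F : Jet n ι → ℝ) (j : Jet n ι) : ℝ :=
  lineDeriv ℝ F j (totalField i j)

/-- The total divergence `Div F = ∑ᵢ D_i F^i`. -/
def Div (F : Fin n → Jet n ι → ℝ) (j : Jet n ι) : ℝ := ∑ i, totalDeriv i (F i) j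

/-- `U` is (the preimage in `J^∞` of) an open subset of some `J^q`. -/
def IsJetDomain [Fintype ι] (U : Set (Jet n ι)) : Prop :=
  ∃ (q : ℕ) (V : Set (JetK n ι q)), IsOpen V ∧ U = proj q ⁻¹' V

/-- `f` is a smooth function on the part of `J^k` lying under `U`. -/
def SmoothOnJetK [Fintype ι] (U : Set (Jet n ι)) (k : ℕ) (f : JetK n ι k → ℝ) : Prop :=
  ContDiffOn ℝ ∞ f (proj k '' U)

/-- `F` is a differential function on `U`: it is a smooth function of `x` and of finitely many
derivatives of `u`. Only the values of `F` on `U` matter. -/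
def IsDiffFun [Fintype ι] (U : Set (Jet n ι)) (F : Jet n ι → ℝ) : Prop :=
  ∃ (k : ℕ) (f : JetK n ι k → ℝ), SmoothOnJetK U k f ∧ ∀ j ∈ U, F j = f (proj k j)

/-! ### Helper facts: differential functions and null divergences form linear spaces -/

lemma trunc_proj {k K : ℕ} (h : k ≤ K) (j : Jet n ι) : trunc h (proj K j) = proj k j := rfl

lemma contDiff_trunc [Fintype ι] {k K : ℕ} (h : k ≤ K) :
    ContDiff ℝ ∞ (trunc h : JetK n ι K → JetK n ι k) := by
  unfold trunc
  fun_prop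

lemma proj_surjective (k : ℕ) : Function.Surjective (proj k : Jet n ι → JetK n ι k) := by
  classical
  intro ξ
  refine ⟨(ξ.1, fun a α => if h : ∑ i, α i ≤ k then ξ.2 a ⟨α, h⟩ else 0), ?_⟩
  refine Prod.ext rfl ?_
  funext a α
  simp [proj, α.2]

lemma SmoothOnJetK.lift [Fintype ι] {U : Set (Jet n ι)} {k K : ℕ} (h : k ≤ K)
    {f : JetK n ι k → ℝ} (hf : SmoothOnJetK U k f) :
    SmoothOnJetK U K (fun ξ => f (trunc h ξ)) := by
  refine ContDiffOn.comp hf (contDiff_trunc h).contDiffOn ?_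
  rintro _ ⟨j, hj, rfl⟩
  exact ⟨j, hj, rfl⟩

lemma IsDiffFun.zero [Fintype ι] (U : Set (Jet n ι)) : IsDiffFun U (0 : Jet n ι → ℝ) :=
  ⟨0, fun _ => 0, contDiffOn_const, fun _ _ => rfl⟩

lemma IsDiffFun.add [Fintype ι] {U : Set (Jet n ι)} {F G : Jet n ι → ℝ}
    (hF : IsDiffFun U F) (hG : IsDiffFun U G) : IsDiffFun U (F + G) := by
  obtain ⟨k, f, hf, hFf⟩ := hF
  obtain ⟨k', g, hg, hGg⟩ := hG
  refine ⟨max k k', fun ξ => f (trunc (le_max_left k k') ξ) + g (trunc (le_max_right k k') ξ),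
    ContDiffOn.add (hf.lift _) (hg.lift _), fun j hj => ?_⟩
  simp [trunc_proj, hFf j hj, hGg j hj]

lemma IsDiffFun.smul [Fintype ι] {U : Set (Jet n ι)} {F : Jet n ι → ℝ} (c : ℝ)
    (hF : IsDiffFun U F) : IsDiffFun U (c • F) := by
  obtain ⟨k, f, hf, hFf⟩ := hF
  refine ⟨k, fun ξ => c * f ξ, ContDiffOn.mul contDiffOn_const hf, fun j hj => ?_⟩
  simp [hFf j hj]

lemma IsDiffFun.lineDifferentiableAt [Fintype ι] {U : Set (Jet n ι)} (hU : IsJetDomain U)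
    {F : Jet n ι → ℝ} (hF : IsDiffFun U F) {j : Jet n ι} (hj : j ∈ U) (w : Jet n ι) :
    LineDifferentiableAt ℝ F j w := by
  obtain ⟨q, V, hV, rfl⟩ := hU
  obtain ⟨k, f, hf, hFf⟩ := hF
  set K := max k q
  have hk : k ≤ K := le_max_left _ _
  have hq : q ≤ K := le_max_right _ _
  have himg : proj K '' (proj q ⁻¹' V : Set (Jet n ι)) = trunc hq ⁻¹' V := by
    ext ξ
    constructor
    · rintro ⟨j, hj, rfl⟩
      exact hj
    · intro hξ
      obtain ⟨j, rfl⟩ := proj_surjective K ξ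
      exact ⟨j, hξ, rfl⟩
  have hopen : IsOpen (trunc hq ⁻¹' V : Set (JetK n ι K)) :=
    hV.preimage (contDiff_trunc hq).continuous
  have hg := hf.lift hk
  unfold SmoothOnJetK at hg
  rw [himg] at hg
  have hjK : proj K j ∈ (trunc hq ⁻¹' V : Set (JetK n ι K)) := hj
  have hdiff : DifferentiableAt ℝ (fun ξ => f (trunc hk ξ)) (proj K j) :=
    (hg.contDiffAt (hopen.mem_nhds hjK)).differentiableAt (by simp)
  have hline : DifferentiableAt ℝ (fun t : ℝ => proj K j + t • proj K w) 0 := by fun_prop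
  have hcomp : DifferentiableAt ℝ (fun t : ℝ => f (trunc hk (proj K j + t • proj K w))) 0 :=
    DifferentiableAt.fun_comp' (g := fun ξ => f (trunc hk ξ)) 0 (by simpa using hdiff) hline
  refine hcomp.congr_of_eventuallyEq ?_
  have hmem : ∀ᶠ t in nhds (0 : ℝ), proj K j + t • proj K w ∈ trunc hq ⁻¹' V :=
    hline.continuousAt.eventually_mem (hopen.mem_nhds (by simpa using hjK))
  filter_upwards [hmem] with t ht
  exact hFf _ ht

lemma Div_add [Fintype ι] {U : Set (Jet n ι)} (hU : IsJetDomain U) {F G : Fin n → Jet n ι → ℝ}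
    (hF : ∀ i, IsDiffFun U (F i)) (hG : ∀ i, IsDiffFun U (G i)) {j : Jet n ι} (hj : j ∈ U) :
    Div (F + G) j = Div F j + Div G j := by
  unfold Div
  rw [← Finset.sum_add_distrib]
  refine Finset.sum_congr rfl fun i _ => ?_
  exact deriv_fun_add ((hF i).lineDifferentiableAt hU hj _) ((hG i).lineDifferentiableAt hU hj _)

lemma Div_zero (j : Jet n ι) : Div (0 : Fin n → Jet n ι → ℝ) j = 0 := by
  simp [Div, totalDeriv, lineDeriv]

lemma Div_smul (c : ℝ) (F : Fin n → Jet n ι → ℝ) (j : Jet n ι) :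
    Div (c • F) j = c * Div F j := by
  simp [Div, totalDeriv, lineDeriv, Finset.mul_sum]

/-! ### Systems of differential equations -/

/-- A system of differential equations `L^1 = 0, …, L^l = 0`; the left-hand sides are differential
functions defined on an open domain of a jet space. -/
structure DESystem (n : ℕ) (ι : Type) [Fintype ι] where
  /-- the domain on which differential functions are considered -/
  dom : Set (Jet n ι)
  isJetDomain_dom : IsJetDomain dom
  /-- the number of equations -/
  l : ℕ
  /-- the left-hand sides of the equations -/
  eqs : Fin l → Jet n ι → ℝ
  isDiffFun_eqs : ∀ μ, IsDiffFun dom (eqs μ)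

namespace DESystem

variable [Fintype ι] (L : DESystem n ι)

/-- `u` is a (smooth, local) solution of the system on the open set `Ω`. -/
structure IsSolution (Ω : Set (Fin n → ℝ)) (u : (Fin n → ℝ) → ι → ℝ) : Prop where
  isOpen : IsOpen Ω
  smooth : ContDiffOn ℝ ∞ u Ω
  mem_dom : ∀ x ∈ Ω, jet u x ∈ L.dom
  eqs_eq_zero : ∀ x ∈ Ω, ∀ μ, L.eqs μ (jet u x) = 0

/-- `H` vanishes on all solutions of the system. -/
def VanishesOnSolutions (H : Jet n ι → ℝ) : Prop :=
  ∀ Ω u, L.IsSolution Ω u → ∀ x ∈ Ω, H (jet u x) = 0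

/-- `H = 0` is a differential consequence of the system: on the domain, `H` is a finite sum
`∑ λ_{μ,α} D^α L^μ` with differential functions `λ_{μ,α}`, that is, `H` belongs to the differential
ideal generated by the `L^μ`. -/
inductive IsConsequence : (Jet n ι → ℝ) → Prop
  | eqs (μ : Fin L.l) : IsConsequence (L.eqs μ)
  | zero : IsConsequence 0
  | add {H G : Jet n ι → ℝ} : IsConsequence H → IsConsequence G → IsConsequence (H + G)
  | mul {c H : Jet n ι → ℝ} : IsDiffFun L.dom c → IsConsequence H → IsConsequence (c * H)
  | totalDeriv (i : Fin n) {H : Jet n ι → ℝ} : IsConsequence H → IsConsequence (totalDeriv i H)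
  | congr {H G : Jet n ι → ℝ} : Set.EqOn H G L.dom → IsConsequence H → IsConsequence G

/-- `h = 0` is a differential consequence of order at most `k`, written on `J^k`. -/
def IsConsequenceK (k : ℕ) (h : JetK n ι k → ℝ) : Prop :=
  SmoothOnJetK L.dom k h ∧ L.IsConsequence (fun j => h (proj k j))

/-- The set `ℒ_(k) ⊆ J^k(x|u)` determined by all differential consequences of order at
most `k`. -/
def manifoldK (k : ℕ) : Set (JetK n ι k) :=
  {ξ | ξ ∈ proj k '' L.dom ∧ ∀ h, L.IsConsequenceK k h → h ξ = 0}

/-- Every point of `ℒ_(k)` is the `k`-jet of a local solution. -/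
def LocallySolvable (k : ℕ) : Prop :=
  ∀ ξ ∈ L.manifoldK k, ∃ Ω u, L.IsSolution Ω u ∧ ∃ x ∈ Ω, proj k (jet u x) = ξ

/-- `ℒ_(k)` is the solution set of an algebraic system on `J^k`, consisting of differential
consequences of order at most `k`, that has maximal rank at each point of `ℒ_(k)`. -/
def MaximalRank (k : ℕ) : Prop :=
  ∃ (r : ℕ) (h : Fin r → JetK n ι k → ℝ),
    (∀ s, L.IsConsequenceK k (h s)) ∧
    (∀ ξ ∈ proj k '' L.dom, (∀ s, h s ξ = 0) → ξ ∈ L.manifoldK k) ∧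
    ∀ ξ ∈ L.manifoldK k, LinearIndependent ℝ (fun s => fderiv ℝ (h s) ξ)

def TotallyNondegenerate : Prop :=
  ∀ k, 1 ≤ k → L.LocallySolvable k ∧ L.MaximalRank k

/-- The space `CV(ℒ)` of conserved vectors. -/
def CV : Submodule ℝ (Fin n → Jet n ι → ℝ) where
  carrier := {F | (∀ i, IsDiffFun L.dom (F i)) ∧ L.VanishesOnSolutions (Div F)}
  add_mem' := by
    rintro F G ⟨hF, hF'⟩ ⟨hG, hG'⟩
    refine ⟨fun i => (hF i).add (hG i), fun Ω u hu x hx => ?_⟩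
    rw [Div_add L.isJetDomain_dom hF hG (hu.mem_dom x hx), hF' Ω u hu x hx, hG' Ω u hu x hx,
      add_zero]
  zero_mem' := ⟨fun _ => IsDiffFun.zero _, fun _ _ _ _ _ => Div_zero _⟩
  smul_mem' := by
    rintro c F ⟨hF, hF'⟩
    refine ⟨fun i => (hF i).smul c, fun Ω u hu x hx => ?_⟩
    rw [Div_smul, hF' Ω u hu x hx, mul_zero]

/-- Tuples of differential functions vanishing on the solutions of the system. -/
def vanishingTuples : Submodule ℝ (Fin n → Jet n ι → ℝ) where
  carrier := {F | ∀ i, IsDiffFun L.dom (F i) ∧ L.VanishesOnSolutions (F i)}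
  add_mem' := by
    intro F G hF hG i
    refine ⟨(hF i).1.add (hG i).1, fun Ω u hu x hx => ?_⟩
    simp [(hF i).2 Ω u hu x hx, (hG i).2 Ω u hu x hx]
  zero_mem' := fun _ => ⟨IsDiffFun.zero _, fun _ _ _ _ _ => rfl⟩
  smul_mem' := by
    intro c F hF i
    refine ⟨(hF i).1.smul c, fun Ω u hu x hx => ?_⟩
    simp [(hF i).2 Ω u hu x hx]

/-- Null divergences: tuples of differential functions whose divergence vanishes identically. -/
def nullDivergences : Submodule ℝ (Fin n → Jet n ι → ℝ) where
  carrier := {F | (∀ i, IsDiffFun L.dom (F i)) ∧ ∀ j ∈ L.dom, Div F j = 0}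
  add_mem' := by
    rintro F G ⟨hF, hF'⟩ ⟨hG, hG'⟩
    refine ⟨fun i => (hF i).add (hG i), fun j hj => ?_⟩
    rw [Div_add L.isJetDomain_dom hF hG hj, hF' j hj, hG' j hj, add_zero]
  zero_mem' := ⟨fun _ => IsDiffFun.zero _, fun _ _ => Div_zero _⟩
  smul_mem' := by
    rintro c F ⟨hF, hF'⟩
    refine ⟨fun i => (hF i).smul c, fun j hj => ?_⟩
    rw [Div_smul, hF' j hj, mul_zero]

/-- The space `CV₀(ℒ)` of trivial conserved vectors `F = F̂ + F̌`, with `F̂` vanishing on the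
solutions and `F̌` a null divergence. -/
def CV₀ : Submodule ℝ L.CV := (L.vanishingTuples ⊔ L.nullDivergences).submoduleOf L.CV

/-- The space `CL(ℒ) = CV(ℒ)/CV₀(ℒ)` of conservation laws. -/
abbrev CL : Type := L.CV ⧸ L.CV₀

/-- The conserved vector `F` belongs to the conservation law `c`. -/
def Belongs (F : L.CV) (c : L.CL) : Prop := Submodule.Quotient.mk F = c

end DESystem

/-! ### Foliated systems -/

variable {m p : ℕ}

/-- The projection `ϖ : J^∞(x|u,v) → J^∞(x|u)`. -/
def varpi (j : Jet n (Fin m ⊕ Fin p)) : Jet n (Fin m) := (j.1, fun a => j.2 (Sum.inl a))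

/-- The projection `ϖ_k : J^k(x|u,v) → J^k(x|u)`. -/
def varpiK (k : ℕ) (ξ : JetK n (Fin m ⊕ Fin p) k) : JetK n (Fin m) k :=
  (ξ.1, fun a => ξ.2 (Sum.inl a))

/-- The system `Lbar` for `(u,v)` is foliated over the base system `L` for `u`. The first condition
says that the domain of `Lbar` lies over the one of `L`; it is automatic if both are
the whole jet spaces. -/
structure IsFoliatedOver (Lbar : DESystem n (Fin m ⊕ Fin p)) (L : DESystem n (Fin m)) :
    Prop where
  image_dom : varpi '' Lbar.dom = L.dom
  base_nondegenerate : L.TotallyNondegenerate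
  total_nondegenerate : Lbar.TotallyNondegenerate
  image_manifoldK : ∀ k, 1 ≤ k → varpiK k '' Lbar.manifoldK k = L.manifoldK k

/-- `Fbar` is the pullback `F ∘ ϖ` of the conserved vector `F`. -/
def IsPullback {Lbar : DESystem n (Fin m ⊕ Fin p)} {L : DESystem n (Fin m)}
    (Fbar : Lbar.CV) (F : L.CV) : Prop :=
  ∀ i, ∀ j ∈ Lbar.dom, Fbar.1 i j = F.1 i (varpi j)

/-- The conservation law `cbar` of `Lbar` is induced by the conservation law `c` of `L`. -/
def IsInducedBy {Lbar : DESystem n (Fin m ⊕ Fin p)} {L : DESystem n (Fin m)}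
    (cbar : Lbar.CL) (c : L.CL) : Prop :=
  ∃ Fbar : Lbar.CV, Lbar.Belongs Fbar cbar ∧ ∃ F : L.CV, L.Belongs F c ∧ IsPullback Fbar F

/-- `Fbar` does not depend on the derivatives of `v` (of any order, including order zero): its
components take equal values at points of the domain which have the same coordinates `x_i`
and `u^a_α`. -/
def NotDependingOnV {Lbar : DESystem n (Fin m ⊕ Fin p)} (Fbar : Lbar.CV) : Prop :=
  ∀ i, ∀ j ∈ Lbar.dom, ∀ j' ∈ Lbar.dom, j.1 = j'.1 →
    (∀ a α, j.2 (Sum.inl a) α = j'.2 (Sum.inl a) α) → Fbar.1 i j = Fbar.1 i j'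

end JetCL

end

namespace JetCL

variable {n : ℕ} {ι : Type}

/-! ### Differential functions in local coordinates -/

/-! A pullback clearly does not see the derivatives of `v` (`IsPullback.notDependingOnV`), so the
content is descent: a conserved vector constant on the fibres of `ϖ` is the pullback of a conserved
vector of the base system.

The components descend to functions on the base domain, the image of the upper one. They stay smooth
because the upper domain is open: freezing the `v`-coordinates gives local smooth sections of `ϖ_k`
(`IsDiffFun.exists_eq_comp_varpi`). Since `ϖ` maps each total derivative field to its counterpart,
divergences descend too (`Div_of_eq_comp_varpi`).

It remains to see that `Div F` vanishes on solutions `u` of the base system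
(`IsFoliatedOver.mem_CV_of_isPullback`). No lift of `u` to a solution `(u,v)` is needed. `Div F` at
a point depends only on a `k`-jet, and the `k`-jet of `u` lies in `ℒ_(k)`, because differential
consequences vanish on solutions. The foliation condition gives a point of the upper manifold above
it, and local solvability upstairs makes that point the jet of a solution, where `Div Fbar`
vanishes. -/

lemma proj_add_smul (k : ℕ) (j w : Jet n ι) (t : ℝ) :
    proj k (j + t • w) = proj k j + t • proj k w := rfl

/-- A domain cut out in `J^q` is equally cut out in every higher `J^K`, so its order can be matched
to that of any differential function. -/
lemma IsJetDomain.exists_order [Fintype ι] {U : Set (Jet n ι)} (hU : IsJetDomain U) :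
    ∃ q, ∀ K, q ≤ K → IsOpen (proj K '' U) ∧ ∀ j, proj K j ∈ proj K '' U → j ∈ U := by
  obtain ⟨q, V, hV, rfl⟩ := hU
  refine ⟨q, fun K hq => ?_⟩
  have himg : proj K '' (proj q ⁻¹' V : Set (Jet n ι)) = trunc hq ⁻¹' V := by
    ext ξ
    constructor
    · rintro ⟨j, hj, rfl⟩
      exact hj
    · intro hξ
      obtain ⟨j, rfl⟩ := proj_surjective K ξ
      exact ⟨j, hξ, rfl⟩
  rw [himg]
  exact ⟨hV.preimage (contDiff_trunc hq).continuous, fun j hj => hj⟩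

/-- A differential function is represented by a smooth function on every jet space of
sufficiently large order. -/
lemma IsDiffFun.exists_order [Fintype ι] {U : Set (Jet n ι)} {F : Jet n ι → ℝ}
    (hF : IsDiffFun U F) :
    ∃ q, ∀ K, q ≤ K → ∃ f, SmoothOnJetK U K f ∧ ∀ j ∈ U, F j = f (proj K j) := by
  obtain ⟨k, f, hf, hFf⟩ := hF
  exact ⟨k, fun K hK => ⟨_, hf.lift hK, hFf⟩⟩

/-- An order that works both for the domain and for a given differential function. -/
lemma IsDiffFun.exists_common_order [Fintype ι] {U : Set (Jet n ι)} (hU : IsJetDomain U)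
    {F : Jet n ι → ℝ} (hF : IsDiffFun U F) :
    ∃ q, IsOpen (proj q '' U) ∧ (∀ j, proj q j ∈ proj q '' U → j ∈ U) ∧
      ∃ f, SmoothOnJetK U q f ∧ ∀ j ∈ U, F j = f (proj q j) := by
  obtain ⟨q, hq⟩ := hU.exists_order
  obtain ⟨r, hr⟩ := hF.exists_order
  obtain ⟨ho, hmem⟩ := hq (max q r) (le_max_left _ _)
  exact ⟨max q r, ho, hmem, hr _ (le_max_right _ _)⟩

lemma IsJetDomain.eventually_mem [Fintype ι] {U : Set (Jet n ι)} (hU : IsJetDomain U)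
    {j : Jet n ι} (hj : j ∈ U) (w : Jet n ι) : ∀ᶠ t in nhds (0 : ℝ), j + t • w ∈ U := by
  obtain ⟨q, hq⟩ := hU.exists_order
  obtain ⟨ho, hmem⟩ := hq q le_rfl
  have hline : ContinuousAt (fun t : ℝ => proj q j + t • proj q w) 0 := by fun_prop
  have : proj q j ∈ proj q '' U := ⟨j, hj, rfl⟩
  filter_upwards [hline.eventually_mem (ho.mem_nhds (by simpa using this))] with t ht
  exact hmem _ ht

lemma SmoothOnJetK.differentiableAt [Fintype ι] {U : Set (Jet n ι)} {k : ℕ}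
    {f : JetK n ι k → ℝ} (hf : SmoothOnJetK U k f) (ho : IsOpen (proj k '' U))
    {j : Jet n ι} (hj : j ∈ U) : DifferentiableAt ℝ f (proj k j) :=
  (ContDiffOn.contDiffAt hf (ho.mem_nhds ⟨j, hj, rfl⟩)).differentiableAt (by simp)

/-- `proj k` sends lines to lines and the domain contains a short piece of the line, so derivatives
on `J^∞` reduce to Fréchet calculus on the finite-dimensional `J^k`. -/
lemma lineDeriv_eq_fderiv_proj [Fintype ι] {U : Set (Jet n ι)} (hU : IsJetDomain U)
    {F : Jet n ι → ℝ} {k : ℕ} {f : JetK n ι k → ℝ} (hFf : ∀ j ∈ U, F j = f (proj k j))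
    {j : Jet n ι} (hj : j ∈ U) (hf : DifferentiableAt ℝ f (proj k j)) (w : Jet n ι) :
    lineDeriv ℝ F j w = fderiv ℝ f (proj k j) (proj k w) := by
  rw [← hf.lineDeriv_eq_fderiv]
  refine Filter.EventuallyEq.deriv_eq ?_
  filter_upwards [hU.eventually_mem hj w] with t ht
  rw [hFf _ ht, proj_add_smul]

lemma IsDiffFun.mul [Fintype ι] {U : Set (Jet n ι)} {F G : Jet n ι → ℝ}
    (hF : IsDiffFun U F) (hG : IsDiffFun U G) : IsDiffFun U (F * G) := by
  obtain ⟨k, f, hf, hFf⟩ := hF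
  obtain ⟨k', g, hg, hGg⟩ := hG
  refine ⟨max k k', fun ξ => f (trunc (le_max_left k k') ξ) * g (trunc (le_max_right k k') ξ),
    ContDiffOn.mul (hf.lift _) (hg.lift _), fun j hj => ?_⟩
  simp [trunc_proj, hFf j hj, hGg j hj]

lemma IsDiffFun.congr [Fintype ι] {U : Set (Jet n ι)} {F G : Jet n ι → ℝ}
    (hF : IsDiffFun U F) (h : Set.EqOn F G U) : IsDiffFun U G := by
  obtain ⟨k, f, hf, hFf⟩ := hF
  exact ⟨k, f, hf, fun j hj => (h hj).symm.trans (hFf j hj)⟩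

lemma IsDiffFun.sum [Fintype ι] {U : Set (Jet n ι)} {σ : Type*} (s : Finset σ)
    {F : σ → Jet n ι → ℝ} (hF : ∀ i, IsDiffFun U (F i)) : IsDiffFun U (∑ i ∈ s, F i) :=
  Finset.sum_induction _ (IsDiffFun U) (fun _ _ => IsDiffFun.add) (IsDiffFun.zero U)
    fun i _ => hF i

/-- The total derivative field in coordinates, as a map `J^{k+1} → J^k`. -/
noncomputable def totalFieldK (i : Fin n) (k : ℕ) (ξ : JetK n ι (k + 1)) : JetK n ι k :=
  (Pi.single i 1, fun a α => ξ.2 a ⟨α.1 + Pi.single i 1, by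
    simpa [Finset.sum_add_distrib] using α.2⟩)

lemma contDiff_totalFieldK [Fintype ι] (i : Fin n) (k : ℕ) :
    ContDiff ℝ ∞ (totalFieldK i k : JetK n ι (k + 1) → JetK n ι k) := by
  unfold totalFieldK
  fun_prop

/-- The order grows by one: the differential of `f` lives on `J^q`, while the direction it is
applied to has components read off `J^{q+1}`. -/
lemma IsDiffFun.totalDeriv [Fintype ι] {U : Set (Jet n ι)} (hU : IsJetDomain U)
    {F : Jet n ι → ℝ} (hF : IsDiffFun U F) (i : Fin n) : IsDiffFun U (totalDeriv i F) := by
  obtain ⟨q, ho, -, f, hf, hFf⟩ := hF.exists_common_order hU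
  refine ⟨q + 1, fun ξ => fderiv ℝ f (trunc (Nat.le_succ q) ξ) (totalFieldK i q ξ), ?_, ?_⟩
  · have h1 : ContDiffOn ℝ ∞ (fderiv ℝ f) (proj q '' U) :=
      ContDiffOn.fderiv_of_isOpen hf ho (by simp)
    refine ContDiffOn.clm_apply (h1.comp (contDiff_trunc _).contDiffOn ?_)
      (contDiff_totalFieldK i q).contDiffOn
    rintro _ ⟨j, hj, rfl⟩
    exact ⟨j, hj, rfl⟩
  · intro j hj
    exact lineDeriv_eq_fderiv_proj hU hFf hj (hf.differentiableAt ho hj) _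

lemma IsDiffFun.Div [Fintype ι] {U : Set (Jet n ι)} (hU : IsJetDomain U)
    {F : Fin n → Jet n ι → ℝ} (hF : ∀ i, IsDiffFun U (F i)) : IsDiffFun U (Div F) :=
  (IsDiffFun.sum Finset.univ fun i => (hF i).totalDeriv hU i).congr fun j _ => by
    simp [JetCL.Div]

/-! ### Iterated partial derivatives of smooth functions -/

section PartialDerivatives

variable {Ω : Set (Fin n → ℝ)} {f g : (Fin n → ℝ) → ℝ}

lemma pderiv_eqOn_fderiv (hΩ : IsOpen Ω) (hf : ContDiffOn ℝ ∞ f Ω) (i : Fin n) :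
    Set.EqOn (pderiv i f) (fun x => fderiv ℝ f x (Pi.single i 1)) Ω := fun _ hx =>
  ((hf.contDiffAt (hΩ.mem_nhds hx)).differentiableAt (by simp)).lineDeriv_eq_fderiv

lemma contDiffOn_pderiv (hΩ : IsOpen Ω) (hf : ContDiffOn ℝ ∞ f Ω) (i : Fin n) :
    ContDiffOn ℝ ∞ (pderiv i f) Ω :=
  ((hf.fderiv_of_isOpen hΩ (by simp)).clm_apply contDiffOn_const).congr
    (pderiv_eqOn_fderiv hΩ hf i)

lemma pderiv_congr (hΩ : IsOpen Ω) (h : Set.EqOn f g Ω) (i : Fin n) :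
    Set.EqOn (pderiv i f) (pderiv i g) Ω := fun _ hx =>
  Filter.EventuallyEq.lineDeriv_eq (h.eventuallyEq_of_mem (hΩ.mem_nhds hx))

/-- Both sides are values of the second Fréchet derivative, which is symmetric for smooth functions.
-/
lemma pderiv_comm (hΩ : IsOpen Ω) (hf : ContDiffOn ℝ ∞ f Ω) (i j : Fin n) :
    Set.EqOn (pderiv i (pderiv j f)) (pderiv j (pderiv i f)) Ω := by
  intro x hx
  have hfx := hf.contDiffAt (hΩ.mem_nhds hx)
  have hd : DifferentiableAt ℝ (fderiv ℝ f) x :=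
    ((hf.fderiv_of_isOpen (m := ∞) hΩ (by simp)).contDiffAt
      (hΩ.mem_nhds hx)).differentiableAt (by simp)
  have key : ∀ i j : Fin n, pderiv i (pderiv j f) x =
      fderiv ℝ (fderiv ℝ f) x (Pi.single i 1) (Pi.single j 1) := fun i j => by
    rw [pderiv_congr hΩ (pderiv_eqOn_fderiv hΩ hf j) i hx, pderiv,
      (hd.clm_apply (differentiableAt_const _)).lineDeriv_eq_fderiv,
      fderiv_clm_apply hd (differentiableAt_const _)]
    simp
  rw [key, key]
  exact (hfx.isSymmSndFDerivAt (by
    rw [minSmoothness_of_isRCLikeNormedField]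
    exact WithTop.coe_le_coe.2 (le_top (a := (2 : ℕ∞))))).eq _ _

lemma contDiffOn_pderiv_iterate (hΩ : IsOpen Ω) (hf : ContDiffOn ℝ ∞ f Ω) (i : Fin n) (k : ℕ) :
    ContDiffOn ℝ ∞ ((pderiv i)^[k] f) Ω := by
  induction k with
  | zero => exact hf
  | succ k ih =>
    rw [Function.iterate_succ_apply']
    exact contDiffOn_pderiv hΩ ih i

lemma pderiv_iterate_congr (hΩ : IsOpen Ω) (h : Set.EqOn f g Ω) (i : Fin n) (k : ℕ) :
    Set.EqOn ((pderiv i)^[k] f) ((pderiv i)^[k] g) Ω := by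
  induction k with
  | zero => exact h
  | succ k ih =>
    rw [Function.iterate_succ_apply', Function.iterate_succ_apply']
    exact pderiv_congr hΩ ih i

lemma pderiv_iterate_comm (hΩ : IsOpen Ω) (hf : ContDiffOn ℝ ∞ f Ω) (i j : Fin n) (k : ℕ) :
    Set.EqOn (pderiv i ((pderiv j)^[k] f)) ((pderiv j)^[k] (pderiv i f)) Ω := by
  induction k with
  | zero => exact Set.eqOn_refl _ _
  | succ k ih =>
    rw [Function.iterate_succ_apply', Function.iterate_succ_apply']
    exact (pderiv_comm hΩ (contDiffOn_pderiv_iterate hΩ hf j k) i j).trans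
      (pderiv_congr hΩ ih j)

lemma contDiffOn_foldr_pderiv (hΩ : IsOpen Ω) (hf : ContDiffOn ℝ ∞ f Ω) (α : Fin n → ℕ)
    (l : List (Fin n)) :
    ContDiffOn ℝ ∞ (l.foldr (fun i g => (pderiv i)^[α i] g) f) Ω := by
  induction l with
  | nil => exact hf
  | cons a l ih => exact contDiffOn_pderiv_iterate hΩ ih a _

lemma contDiffOn_mderiv (hΩ : IsOpen Ω) (hf : ContDiffOn ℝ ∞ f Ω) (α : Fin n → ℕ) :
    ContDiffOn ℝ ∞ (mderiv α f) Ω :=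
  contDiffOn_foldr_pderiv hΩ hf α _

lemma foldr_pderiv_of_notMem (α : Fin n → ℕ) (i : Fin n) (l : List (Fin n)) (hi : i ∉ l) :
    l.foldr (fun k g => (pderiv k)^[(α + Pi.single i 1 : Fin n → ℕ) k] g) f =
      l.foldr (fun k g => (pderiv k)^[α k] g) f := by
  induction l with
  | nil => rfl
  | cons a l ih =>
    rw [List.mem_cons, not_or] at hi
    rw [List.foldr_cons, List.foldr_cons, ih hi.2]
    simp [Pi.single_eq_of_ne (Ne.symm hi.1)]

/-- `mderiv` nests the partial derivatives in a fixed order, so the extra `∂_i` is commuted inwards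
past the other variables until it meets its own block. As the list has no duplicates, exactly one
block grows. -/
lemma pderiv_foldr_pderiv (hΩ : IsOpen Ω) (hf : ContDiffOn ℝ ∞ f Ω) (α : Fin n → ℕ) (i : Fin n)
    (l : List (Fin n)) (hl : l.Nodup) (hi : i ∈ l) :
    Set.EqOn (pderiv i (l.foldr (fun k g => (pderiv k)^[α k] g) f))
      (l.foldr (fun k g => (pderiv k)^[(α + Pi.single i 1 : Fin n → ℕ) k] g) f) Ω := by
  induction l with
  | nil => simp at hi
  | cons a l ih =>
    rw [List.nodup_cons] at hl
    rw [List.foldr_cons, List.foldr_cons]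
    by_cases h : i = a
    · subst h
      rw [foldr_pderiv_of_notMem α i l hl.1, Pi.add_apply, Pi.single_eq_same,
        Function.iterate_succ_apply']
      exact Set.eqOn_refl _ _
    · have hil : i ∈ l := (List.mem_cons.1 hi).resolve_left h
      rw [Pi.add_apply, Pi.single_eq_of_ne (Ne.symm h), add_zero]
      exact (pderiv_iterate_comm hΩ (contDiffOn_foldr_pderiv hΩ hf α l) i a _).trans
        (pderiv_iterate_congr hΩ (ih hl.2 hil) a _)

lemma pderiv_mderiv (hΩ : IsOpen Ω) (hf : ContDiffOn ℝ ∞ f Ω) (α : Fin n → ℕ) (i : Fin n) :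
    Set.EqOn (pderiv i (mderiv α f)) (mderiv (α + Pi.single i 1) f) Ω :=
  pderiv_foldr_pderiv hΩ hf α i _ (List.nodup_finRange n) (List.mem_finRange i)

end PartialDerivatives

/-- Along the jet of a smooth function, the total derivative field is the velocity of the
coordinate lines. -/
lemma hasDerivAt_proj_jet [Fintype ι] {Ω : Set (Fin n → ℝ)} {u : (Fin n → ℝ) → ι → ℝ}
    (hΩ : IsOpen Ω) (hu : ContDiffOn ℝ ∞ u Ω) {x : Fin n → ℝ} (hx : x ∈ Ω) (i : Fin n) (k : ℕ) :
    HasDerivAt (fun t : ℝ => proj k (jet u (x + t • Pi.single i 1)))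
      (proj k (totalField i (jet u x))) 0 := by
  refine HasDerivAt.prodMk ?_ ?_
  · simpa [totalField, jet] using
      ((hasDerivAt_id (0 : ℝ)).smul_const (Pi.single i (1 : ℝ) : Fin n → ℝ)).const_add x
  · refine hasDerivAt_pi.2 fun a => hasDerivAt_pi.2 fun α => ?_
    have hua : ContDiffOn ℝ ∞ (fun y => u y a) Ω := contDiffOn_pi.1 hu a
    have hd : DifferentiableAt ℝ (mderiv α.1 fun y => u y a) x :=
      ((contDiffOn_mderiv hΩ hua α.1).contDiffAt (hΩ.mem_nhds hx)).differentiableAt (by simp)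
    have h := (hd.lineDifferentiableAt (v := Pi.single i (1 : ℝ))).hasDerivAt
    -- Differentiating the coordinate `u^a_α` along `x_i` yields `u^a_{α+δ_i}`, the matching
    -- component of `totalField`.
    have e : deriv (fun t : ℝ => mderiv α.1 (fun y => u y a) (x + t • Pi.single i 1)) 0 =
      mderiv (α.1 + Pi.single i 1) (fun y => u y a) x := pderiv_mderiv hΩ hua α.1 i hx
    rw [e] at h
    exact h

/-! ### Differential consequences vanish on solutions -/

namespace DESystem

variable [Fintype ι] {L : DESystem n ι}

lemma IsConsequence.isDiffFun {H : Jet n ι → ℝ} (hH : L.IsConsequence H) :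
    IsDiffFun L.dom H := by
  induction hH with
  | eqs μ => exact L.isDiffFun_eqs μ
  | zero => exact IsDiffFun.zero _
  | add _ _ h₁ h₂ => exact h₁.add h₂
  | mul hc _ h => exact hc.mul h
  | totalDeriv i _ h => exact h.totalDeriv L.isJetDomain_dom i
  | congr e _ h => exact h.congr e

/-- By the chain rule, `D_i H` on the jet of a solution is the ordinary `x_i`-derivative of `H`
along that jet, and this function is zero near `x`. -/
lemma VanishesOnSolutions.totalDeriv {H : Jet n ι → ℝ} (hd : IsDiffFun L.dom H)
    (hH : L.VanishesOnSolutions H) (i : Fin n) : L.VanishesOnSolutions (totalDeriv i H) := by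
  intro Ω u hu x hx
  obtain ⟨q, ho, -, f, hf, hHf⟩ := hd.exists_common_order L.isJetDomain_dom
  have hj := hu.mem_dom x hx
  have hfd := hf.differentiableAt ho hj
  rw [JetCL.totalDeriv, lineDeriv_eq_fderiv_proj L.isJetDomain_dom hHf hj hfd]
  have hc := hasDerivAt_proj_jet hu.isOpen hu.smooth hx i q
  have h0 : proj q (jet u x) = proj q (jet u (x + (0 : ℝ) • Pi.single i 1)) := by simp
  have hcomp := HasFDerivAt.comp_hasDerivAt (0 : ℝ) (h0 ▸ hfd.hasFDerivAt) hc
  have hline : ContinuousAt (fun t : ℝ => x + t • (Pi.single i 1 : Fin n → ℝ)) 0 := by fun_prop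
  have hz : (fun t : ℝ => f (proj q (jet u (x + t • Pi.single i 1)))) =ᶠ[nhds 0]
      fun _ => (0 : ℝ) := by
    filter_upwards [hline.eventually_mem (hu.isOpen.mem_nhds (by simpa using hx))] with t ht
    rw [← hHf _ (hu.mem_dom _ ht)]
    exact hH Ω u hu _ ht
  have := hcomp.deriv.symm.trans (hz.deriv_eq.trans (deriv_const _ _))
  rwa [← h0] at this

lemma IsConsequence.vanishesOnSolutions {H : Jet n ι → ℝ} (hH : L.IsConsequence H) :
    L.VanishesOnSolutions H := by
  induction hH with
  | eqs μ => exact fun Ω u hu x hx => hu.eqs_eq_zero x hx μ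
  | zero => exact fun _ _ _ _ _ => rfl
  | add _ _ h₁ h₂ =>
    exact fun Ω u hu x hx => by rw [Pi.add_apply, h₁ Ω u hu x hx, h₂ Ω u hu x hx, add_zero]
  | mul _ _ h => exact fun Ω u hu x hx => by rw [Pi.mul_apply, h Ω u hu x hx, mul_zero]
  | totalDeriv i hc h => exact h.totalDeriv hc.isDiffFun i
  | congr e _ h => exact fun Ω u hu x hx => (e (hu.mem_dom x hx)).symm.trans (h Ω u hu x hx)

lemma IsSolution.proj_jet_mem_manifoldK {Ω : Set (Fin n → ℝ)} {u : (Fin n → ℝ) → ι → ℝ}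
    (hu : L.IsSolution Ω u) {x : Fin n → ℝ} (hx : x ∈ Ω) (k : ℕ) :
    proj k (jet u x) ∈ L.manifoldK k :=
  ⟨⟨_, hu.mem_dom x hx, rfl⟩, fun _ h => h.2.vanishesOnSolutions Ω u hu x hx⟩

end DESystem

/-! ### Descent along the projection forgetting `v` -/

variable {m p : ℕ}

lemma varpiK_proj (k : ℕ) (j : Jet n (Fin m ⊕ Fin p)) :
    varpiK k (proj k j) = proj k (varpi j) := rfl

lemma varpi_add_smul_totalField (i : Fin n) (j : Jet n (Fin m ⊕ Fin p)) (t : ℝ) :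
    varpi (j + t • totalField i j) = varpi j + t • totalField i (varpi j) := rfl

/-- The line through `j` along the total derivative field is mapped by `ϖ` to the corresponding line
below, so the two functions of `t` agree near `0`; no differentiability is involved. -/
lemma Div_of_eq_comp_varpi {Ubar : Set (Jet n (Fin m ⊕ Fin p))} (hU : IsJetDomain Ubar)
    {Fbar : Fin n → Jet n (Fin m ⊕ Fin p) → ℝ} {F : Fin n → Jet n (Fin m) → ℝ}
    (h : ∀ i, ∀ j ∈ Ubar, Fbar i j = F i (varpi j)) {j : Jet n (Fin m ⊕ Fin p)} (hj : j ∈ Ubar) :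
    Div Fbar j = Div F (varpi j) := by
  refine Finset.sum_congr rfl fun i _ => Filter.EventuallyEq.deriv_eq ?_
  filter_upwards [hU.eventually_mem hj (totalField i j)] with t ht
  rw [h i _ ht, varpi_add_smul_totalField]

/-- The point of `J^k(x|u,v)` with the `(x,u)`-coordinates of `ξ` and the `v`-coordinates
of `η`. -/
def withV (k : ℕ) (η : JetK n (Fin m ⊕ Fin p) k) (ξ : JetK n (Fin m) k) :
    JetK n (Fin m ⊕ Fin p) k :=
  (ξ.1, fun a => Sum.elim (fun b => ξ.2 b) (fun c => η.2 (Sum.inr c)) a)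

lemma varpiK_withV (k : ℕ) (η : JetK n (Fin m ⊕ Fin p) k) (ξ : JetK n (Fin m) k) :
    varpiK k (withV k η ξ) = ξ := rfl

lemma withV_varpiK (k : ℕ) (η : JetK n (Fin m ⊕ Fin p) k) : withV k η (varpiK k η) = η := by
  refine Prod.ext rfl (funext fun a => ?_)
  cases a <;> rfl

lemma contDiff_withV (k : ℕ) (η : JetK n (Fin m ⊕ Fin p) k) : ContDiff ℝ ∞ (withV k η) := by
  refine contDiff_fst.prodMk (contDiff_pi.2 fun a => ?_)
  cases a
  · exact (contDiff_apply ℝ _ _).comp contDiff_snd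
  · exact contDiff_const

/-- A differential function of `(u,v)` that takes equal values at points of the domain with the
same `x` and the same derivatives of `u` is the pullback of a differential function of `u`. -/
lemma IsDiffFun.exists_eq_comp_varpi {Ubar : Set (Jet n (Fin m ⊕ Fin p))}
    (hU : IsJetDomain Ubar) {Fbar : Jet n (Fin m ⊕ Fin p) → ℝ} (hF : IsDiffFun Ubar Fbar)
    (hv : ∀ j ∈ Ubar, ∀ j' ∈ Ubar, varpi j = varpi j' → Fbar j = Fbar j') :
    ∃ F : Jet n (Fin m) → ℝ, IsDiffFun (varpi '' Ubar) F ∧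
      ∀ j ∈ Ubar, Fbar j = F (varpi j) := by
  classical
  obtain ⟨q, ho, hmem, f, hf, hFf⟩ := hF.exists_common_order hU
  set W := proj q '' Ubar
  have himg : proj q '' (varpi '' Ubar) = varpiK q '' W := by
    rw [Set.image_image, Set.image_image]
    rfl
  have hconst : ∀ ξ ∈ W, ∀ ξ' ∈ W, varpiK q ξ = varpiK q ξ' → f ξ = f ξ' := by
    rintro ξ ⟨j, hj, rfl⟩ ξ' ⟨j', hj', rfl⟩ e
    -- `hv` asks for equal derivatives of `u` of all orders, but here only those of order at most
    -- `q` agree. The hybrid jet takes `u` from `j` and `v` from `j'`: it has the same `q`-jet as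
    -- `j'`, hence lies in the domain, and the same image under `ϖ` as `j`.
    have hproj : proj q ((j.1, fun a => Sum.elim (fun b => j.2 (Sum.inl b))
        (fun c => j'.2 (Sum.inr c)) a) : Jet n (Fin m ⊕ Fin p)) = proj q j' := by
      refine Prod.ext (show j.1 = j'.1 from congrArg (fun ξ => ξ.1) e) (funext fun a => ?_)
      cases a with
      | inl b => exact congrFun (congrArg (fun ξ => ξ.2) e) b
      | inr c => rfl
    have hj'' := hmem _ (hproj ▸ (⟨j', hj', rfl⟩ : proj q j' ∈ W))
    rw [← hFf j hj, ← hproj, ← hFf _ hj'']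
    exact hv _ hj _ hj'' rfl
  -- The value `0` off the image of `W` is harmless, since smoothness is required only on that
  -- image.
  set g : JetK n (Fin m) q → ℝ := fun ξ =>
    if h : ∃ η ∈ W, varpiK q η = ξ then f h.choose else 0
  have hg : ∀ η ∈ W, g (varpiK q η) = f η := fun η hη => by
    have hex : ∃ η' ∈ W, varpiK q η' = varpiK q η := ⟨η, hη, rfl⟩
    simp only [g, dif_pos hex]
    exact hconst _ hex.choose_spec.1 _ hη hex.choose_spec.2
  refine ⟨fun j => g (proj q j), ⟨q, g, ?_, fun _ _ => rfl⟩, fun j hj => ?_⟩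
  · unfold SmoothOnJetK
    rw [himg]
    rintro _ ⟨η, hη, rfl⟩
    -- The choice made in `g` has no regularity of its own; near `varpiK q η`, however, `g` equals
    -- `f` on the smooth section with `v` frozen at `η`, which stays in the open set `W`.
    have hc : ContDiffAt ℝ ∞ (fun ξ => f (withV q η ξ)) (varpiK q η) := by
      refine ContDiffAt.comp (g := f) _ ?_ (contDiff_withV q η).contDiffAt
      rw [withV_varpiK]
      exact ContDiffOn.contDiffAt hf (ho.mem_nhds hη)
    refine (hc.congr_of_eventuallyEq ?_).contDiffWithinAt
    have hW : ∀ᶠ ξ in nhds (varpiK q η), withV q η ξ ∈ W :=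
      (contDiff_withV q η).continuous.continuousAt.eventually_mem
        (ho.mem_nhds (by rwa [withV_varpiK]))
    filter_upwards [hW] with ξ hξ
    rw [← hg _ hξ, varpiK_withV]
  · exact (hFf j hj).trans (hg _ ⟨j, hj, rfl⟩).symm

lemma IsFoliatedOver.mem_CV_of_isPullback {Lbar : DESystem n (Fin m ⊕ Fin p)}
    {L : DESystem n (Fin m)} (hfol : IsFoliatedOver Lbar L) (Fbar : Lbar.CV)
    {F : Fin n → Jet n (Fin m) → ℝ} (hF : ∀ i, IsDiffFun L.dom (F i))
    (h : ∀ i, ∀ j ∈ Lbar.dom, Fbar.1 i j = F i (varpi j)) : F ∈ L.CV := by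
  refine ⟨hF, fun Ω u hu x hx => ?_⟩
  obtain ⟨q, hq⟩ := (IsDiffFun.Div L.isJetDomain_dom hF).exists_order
  -- The order `q + 1` is used because the foliation and nondegeneracy conditions are imposed only
  -- for `k ≥ 1`.
  obtain ⟨d, -, hd⟩ := hq (q + 1) (Nat.le_succ q)
  have hmem := hu.proj_jet_mem_manifoldK hx (q + 1)
  rw [← hfol.image_manifoldK (q + 1) (Nat.le_add_left 1 q)] at hmem
  obtain ⟨η, hη, hηu⟩ := hmem
  obtain ⟨Ω', w, hw, y, hy, rfl⟩ :=
    (hfol.total_nondegenerate (q + 1) (Nat.le_add_left 1 q)).1 η hη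
  have hjbar := hw.mem_dom y hy
  have hj : varpi (jet w y) ∈ L.dom := hfol.image_dom ▸ Set.mem_image_of_mem _ hjbar
  -- The jets of `u` at `x` and of the `u`-part of `w` at `y` may differ above order `q + 1`, but
  -- `Div F` is computed by `d` from the common part.
  rw [hd _ (hu.mem_dom x hx), ← hηu, varpiK_proj, ← hd _ hj,
    ← Div_of_eq_comp_varpi Lbar.isJetDomain_dom h hjbar]
  exact Fbar.2.2 Ω' w hw y hy

lemma IsFoliatedOver.exists_isPullback {Lbar : DESystem n (Fin m ⊕ Fin p)}
    {L : DESystem n (Fin m)} (hfol : IsFoliatedOver Lbar L) (Fbar : Lbar.CV)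
    (hv : NotDependingOnV Fbar) : ∃ F : L.CV, IsPullback Fbar F := by
  have key := fun i => (Fbar.2.1 i).exists_eq_comp_varpi Lbar.isJetDomain_dom
    fun j hj j' hj' e => hv i j hj j' hj' (congrArg (fun ξ => ξ.1) e)
      fun a α => congrArg (fun ξ => ξ.2 a α) e
  choose F hF hFbar using key
  rw [hfol.image_dom] at hF
  exact ⟨⟨F, hfol.mem_CV_of_isPullback Fbar hF hFbar⟩, hFbar⟩

lemma IsPullback.notDependingOnV {Lbar : DESystem n (Fin m ⊕ Fin p)} {L : DESystem n (Fin m)}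
    {Fbar : Lbar.CV} {F : L.CV} (h : IsPullback Fbar F) : NotDependingOnV Fbar := by
  intro i j hj j' hj' hx hu
  rw [h i j hj, h i j' hj']
  exact congrArg (F.1 i) (Prod.ext hx (funext fun a => funext fun α => hu a α))

end JetCL

theorem mainTheorem5 {n m p : ℕ}
    (Lbar : JetCL.DESystem n (Fin m ⊕ Fin p)) (L : JetCL.DESystem n (Fin m))
    (hfol : JetCL.IsFoliatedOver Lbar L) (cbar : Lbar.CL) :
    ((∃ c : L.CL, JetCL.IsInducedBy cbar c) ↔
      ∃ Fbar : Lbar.CV, Lbar.Belongs Fbar cbar ∧ JetCL.NotDependingOnV Fbar) ∧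
    ∀ Fbar : Lbar.CV, Lbar.Belongs Fbar cbar → JetCL.NotDependingOnV Fbar →
      ∃ c : L.CL, JetCL.IsInducedBy cbar c ∧
        ∃ F : L.CV, L.Belongs F c ∧ JetCL.IsPullback Fbar F := by
  have descend : ∀ Fbar : Lbar.CV, Lbar.Belongs Fbar cbar → JetCL.NotDependingOnV Fbar →
      ∃ c : L.CL, JetCL.IsInducedBy cbar c ∧
        ∃ F : L.CV, L.Belongs F c ∧ JetCL.IsPullback Fbar F := by
    intro Fbar hb hv
    obtain ⟨F, hF⟩ := hfol.exists_isPullback Fbar hv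
    exact ⟨Submodule.Quotient.mk F, ⟨Fbar, hb, F, rfl, hF⟩, F, rfl, hF⟩
  refine ⟨⟨?_, ?_⟩, descend⟩
  · rintro ⟨c, Fbar, hb, F, -, hF⟩
    exact ⟨Fbar, hb, hF.notDependingOnV⟩
  · rintro ⟨Fbar, hb, hv⟩
    obtain ⟨c, hc, -⟩ := descend Fbar hb hv
    exact ⟨c, hc⟩
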